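/- Let $d\ge 1$, $b<0$, $G(u)=u_1-b$ for $u\in\mathbb R^d$, and $\widetilde G=\max\{0,G\}$. Let $U_0^{(1)},U_0^{(2)},\dots$ be independent standard Gaussian random vectors in $\mathbb R^d$. For an ensemble $\mathbf u=(u^{(1)},\dots,u^{(J)})$ write $\overline u=\frac1J\sum_k u^{(k)}$, $\overline{\widetilde G}=\frac1J\sum_k\widetilde G(u^{(k)})$, $$C_{\mathrm{up}}(\mathbf u)=\frac1J\sum_{k=1}^J\bigl(\widetilde G(u^{(k)})-\overline{\widetilde G}\bigr)\bigl(u^{(k)}-\overline u\bigr),\qquad C_{\mathrm{pp}}(\mathbf u)=\frac1J\sum_{k=1}^J\bigl(\widetilde G(u^{(k)})-\overline{\widetilde G}\bigr)^2 .$$ The noise-free ensemble Kalman filter (EnKF) with step size $h>0$ (data $0$, unit observational variance) is the iteration $$u_{n+1}^{(j)}=u_n^{(j)}-C_{\mathrm{up}}(\mathbf u_n)\Bigl(C_{\mathrm{pp}}(\mathbf u_n)+\tfrac1h\Bigr)^{-1}\widetilde G(u_n^{(j)}),\qquad u_0^{(j)}=U_0^{(j)},\quad j=1,\dots,J.$$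 For every $J$ and $t\ge 0$ the iterates after $\lfloor t/h\rfloor$ steps converge as $h\to0$ to an ensemble $\mathbf u_J(t)=(u_J^{(j)}(t))_{j\le J}$, which starts at $(U_0^{(j)})_{j\le J}$ and solves for $t\ge0$ $$\frac{\mathrm d u^{(j)}}{\mathrm dt}=\frac1J\sum_{k=1}^J\bigl(\widetilde G(u^{(k)})-\overline{\widetilde G}\bigr)\bigl(-\widetilde G(u^{(j)})\bigr)\bigl(u^{(k)}-\overline u\bigr),\qquad j=1,\dots,J .$$ Almost surely, for all $t\ge0$, as $J\to\infty$ the empirical measures of $\mathbf u_J(t)$ converge weakly to a (deterministic) probability measure $\mu_t$ with finite mean $m(t)=\int x\,\mathrm d\mu_t(x)$, and the ensemble means $\frac1J\sum_{j=1}^J u_J^{(j)}(t)$ converge to $m(t)$. Moreover $$\lim_{t\to\infty}m(t)=(1-P_f)\,u^{\mathrm{MLFP}}+P_f\,u^{\mathrm{opt}} .$$ Here, for $U$ standard Gaussian in $\mathbb R^d$, $P_f=\mathbb P(G(U)<0)$, $u^{\mathrm{opt}}=\mathbb E[U\mid G(U)<0]=\mathbb E[U\mid U_1<b]$ is the mean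 of the optimal importance sampling density, and $u^{\mathrm{MLFP}}=(b,0,\dots,0)$ is the most likely failure point, i.e. the unique minimizer of $\frac12\|u\|_2^2$ subject to $G(u)=0$. -/

import Mathlib

open Filter Topology MeasureTheory ProbabilityTheory

noncomputable section

namespace EnKF

/-- The parameter space `ℝ^d` with its Euclidean norm. -/
abbrev Space (d : ℕ) : Type := EuclideanSpace ℝ (Fin d)

/-- The ensemble average `(1/J) ∑ₖ f k`. -/
def avg {E : Type*} [AddCommGroup E] [Module ℝ E] {J : ℕ} (f : Fin J → E) : E :=
  (J : ℝ)⁻¹ • ∑ k, f k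

/-- The auxiliary limit state function `G̃ = max {0, G}`. -/
def aux {d : ℕ} (G : Space d → ℝ) (u : Space d) : ℝ := max 0 (G u)

/-- Empirical cross-covariance of the particles and their images under the forward map `g`. -/
def covUP {d J : ℕ} (g : Space d → ℝ) (u : Fin J → Space d) : Space d :=
  avg fun k => (g (u k) - avg fun i => g (u i)) • (u k - avg u)

/-- Empirical variance of the images of the particles under the forward map `g`. -/
def covPP {d J : ℕ} (g : Space d → ℝ) (u : Fin J → Space d) : ℝ :=
  avg fun k => (g (u k) - avg fun i => g (u i)) ^ 2

/-- One noise-free EnKF update with step size `h`, forward map `G̃`, data `0` and unit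
observational variance. -/
def step {d J : ℕ} (G : Space d → ℝ) (h : ℝ) (u : Fin J → Space d) : Fin J → Space d :=
  fun j => u j + ((covPP (aux G) u + 1 / h)⁻¹ * (0 - aux G (u j))) • covUP (aux G) u

/-- The ensemble after `n` noise-free EnKF updates of step size `h`, started at `u₀`. -/
def iter {d J : ℕ} (G : Space d → ℝ) (h : ℝ) (u₀ : Fin J → Space d) (n : ℕ) :
    Fin J → Space d :=
  (step G h)^[n] u₀

/-- `u` is the continuous-time noise-free EnKF started at `u₀`: on `[0, ∞)` it solves
`du⁽ʲ⁾/dt = (1/J) ∑ₖ (G̃(u⁽ᵏ⁾) - mean of G̃) (-G̃(u⁽ʲ⁾)) (u⁽ᵏ⁾ - mean of u)`,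
and at each time `t ≥ 0` it is the limit, as the step size `h` tends to `0`, of the
EnKF iterates after `⌊t / h⌋` steps. -/
structure IsContinuousTimeLimit {d J : ℕ} (G : Space d → ℝ) (u₀ : Fin J → Space d)
    (u : ℝ → Fin J → Space d) : Prop where
  initial : u 0 = u₀
  flow : ∀ t : ℝ, 0 ≤ t → ∀ j : Fin J,
    HasDerivWithinAt (fun s => u s j)
      (avg fun k => ((aux G (u t k) - avg fun i => aux G (u t i)) * (-aux G (u t j))) •
        (u t k - avg (u t)))
      (Set.Ici 0) t
  limit : ∀ t : ℝ, 0 ≤ t →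
    Tendsto (fun h : ℝ => iter G h u₀ ⌊t / h⌋₊) (𝓝[>] 0) (𝓝 (u t))

/-- `μ` is the large-ensemble limit of a family of ensembles `v J` of sizes `J = 0, 1, 2, …`: it is
the weak limit of their empirical measures, it has a mean, and the ensemble means converge to
that mean. -/
structure IsLargeEnsembleLimit {d : ℕ} (v : (J : ℕ) → Fin J → Space d)
    (μ : ProbabilityMeasure (Space d)) : Prop where
  weak : ∀ f : BoundedContinuousFunction (Space d) ℝ,
    Tendsto (fun J => avg fun j => f (v J j)) atTop (𝓝 (∫ x, f x ∂(μ : Measure (Space d))))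
  integrable : Integrable (fun x : Space d => x) (μ : Measure (Space d))
  mean : Tendsto (fun J => avg (v J)) atTop (𝓝 (∫ x, x ∂(μ : Measure (Space d))))

/-- The affine limit state function `G(u) = u₁ - b`. -/
def affineLSF (d : ℕ) [NeZero d] (b : ℝ) (u : Space d) : ℝ := u 0 - b

/-- The probability of failure `P_f = ℙ(G(U) < 0)` for a standard Gaussian `U`. -/
def failureProb {d : ℕ} (G : Space d → ℝ) : ℝ := (stdGaussian (Space d)).real {u | G u < 0}

/-- The mean `𝔼[U ∣ G(U) < 0]`, for a standard Gaussian `U`, of the optimal importance sampling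
density. -/
def optMean {d : ℕ} (G : Space d → ℝ) : Space d :=
  ∫ u, u ∂(cond (stdGaussian (Space d)) {u | G u < 0})

/-- `u` is a most likely failure point: it minimizes `‖u‖² / 2` subject to `G(u) = 0`. -/
def IsMLFP {d : ℕ} (G : Space d → ℝ) (u : Space d) : Prop :=
  G u = 0 ∧ ∀ v : Space d, G v = 0 → 1 / 2 * ‖u‖ ^ 2 ≤ 1 / 2 * ‖v‖ ^ 2

end EnKF

end

/-!
Write `A = Var G̃` and `A + B = Cov(G̃, u₁)` for the covariances of an ensemble and let `e` be the
direction of `Cov(G̃, u)`, scaled such that `e₁ = 1`. Moving the points by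
`x ↦ x - (1 - ρ) G̃(x) e` multiplies all values of `G̃` by `ρ`, hence `Cov(G̃, u)` becomes
`ρ (A ρ + B) e`: the family of these ensembles is invariant under the filter, which only moves the
scalar `ρ`. In continuous time `ρ` is the solution `r` of `r' = -r² (A r + B)`, `r 0 = 1`, and the
filter is a perturbed Euler scheme for this equation. By the law of large numbers `A`, `B` and `e`
converge to the values of the population, and so do `r`, the empirical measures and the means.

For a Gaussian population, invariance under reflection in the first axis forces `e` to be the first
unit vector. Since `A > 0` and `B ≥ 0`, `r` tends to `0`: in the limit `t → ∞` the points with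
`G < 0` have not moved, and the others have been projected onto `G = 0`. The former have mean
`u^opt`, the latter `u^MLFP`, again by reflection.
-/

namespace EnKF

section IntegralCurves

variable {E : Type*} [NormedAddCommGroup E] [NormedSpace ℝ E]

theorem exists_forall_Ioo_hasDerivAt_of_lipschitzWith [CompleteSpace E] {f : E → E} {K L : NNReal}
    (hf : LipschitzWith K f) (hL : ∀ x, ‖f x‖ ≤ L) (x₀ : E) (n : ℕ) :
    ∃ x : ℝ → E, x 0 = x₀ ∧
      ∀ t ∈ Set.Ioo (-(n + 1 : ℝ)) (n + 1), HasDerivAt x (f (x t)) t := by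
  have h0 : (0 : ℝ) ∈ Set.Icc (-(n + 1 : ℝ)) (n + 1) := by
    constructor <;> linarith [n.cast_nonneg (α := ℝ)]
  have hp : IsPicardLindelof (fun _ ↦ f) (⟨0, h0⟩ : Set.Icc (-(n + 1 : ℝ)) (n + 1)) x₀
      (L * (n + 1)) 0 L K :=
    .of_time_independent (fun x _ ↦ hL x) hf.lipschitzOnWith (by simp)
  obtain ⟨x, hx0, hx⟩ := hp.exists_eq_forall_mem_Icc_hasDerivWithinAt₀
  exact ⟨x, hx0, fun t ht ↦ (hx t (Set.Ioo_subset_Icc_self ht)).hasDerivAt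
    (Icc_mem_nhds ht.1 ht.2)⟩

theorem exists_forall_hasDerivAt_of_lipschitzWith [CompleteSpace E] {f : E → E} {K L : NNReal}
    (hf : LipschitzWith K f) (hL : ∀ x, ‖f x‖ ≤ L) (x₀ : E) :
    ∃ x : ℝ → E, x 0 = x₀ ∧ ∀ t, HasDerivAt x (f (x t)) t := by
  choose y hy0 hy using exists_forall_Ioo_hasDerivAt_of_lipschitzWith hf hL x₀
  have agree {m n : ℕ} (hmn : m ≤ n) : Set.EqOn (y m) (y n) (Set.Ioo (-(m + 1)) (m + 1)) := by
    have hmn' : (m : ℝ) ≤ n := mod_cast hmn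
    exact ODE_solution_unique_of_mem_Ioo (v := fun _ ↦ f) (s := fun _ ↦ Set.univ) (t₀ := 0)
      (fun _ _ ↦ hf.lipschitzOnWith) ⟨by linarith [m.cast_nonneg (α := ℝ)], by positivity⟩
      (fun t ht ↦ ⟨hy m t ht, trivial⟩)
      (fun t ht ↦ ⟨hy n t ⟨by linarith [ht.1], by linarith [ht.2]⟩, trivial⟩) (by rw [hy0, hy0])
  refine ⟨fun t ↦ y ⌈|t|⌉₊ t, by simp [hy0], fun t ↦ ?_⟩
  have mem_Ioo (s : ℝ) : s ∈ Set.Ioo (-(⌈|s|⌉₊ + 1 : ℝ)) (⌈|s|⌉₊ + 1) :=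
    abs_lt.1 ((Nat.le_ceil _).trans_lt (by linarith))
  refine (hy _ t (mem_Ioo t)).congr_of_eventuallyEq ?_
  filter_upwards [Ioo_mem_nhds (mem_Ioo t).1 (mem_Ioo t).2] with s hs
  obtain h | h := le_total ⌈|s|⌉₊ ⌈|t|⌉₊
  · exact agree h (mem_Ioo s)
  · exact (agree h hs).symm

/-- `x` solves `x' = f x` on `[0, ∞)` with initial value `x₀`, without leaving the region `s`; the
derivative at time `0` is the one-sided one. -/
structure IsForwardSolution (f : E → E) (s : Set E) (x₀ : E) (x : ℝ → E) : Prop where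
  initial : x 0 = x₀
  mem : ∀ t, 0 ≤ t → x t ∈ s
  deriv : ∀ t, 0 ≤ t → HasDerivWithinAt x (f (x t)) (Set.Ici 0) t

namespace IsForwardSolution

variable {f : E → E} {s : Set E} {x₀ : E} {x : ℝ → E} {K : NNReal} {M C h t : ℝ}

theorem continuousOn (hx : IsForwardSolution f s x₀ x) : ContinuousOn x (Set.Ici 0) :=
  fun t ht ↦ (hx.deriv t ht).continuousWithinAt

theorem dist_le_of_norm_le (hx : IsForwardSolution f s x₀ x) (hM : ∀ y ∈ s, ‖f y‖ ≤ M) {t₁ t₂ : ℝ}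
    (h₁ : 0 ≤ t₁) (h₂ : 0 ≤ t₂) : dist (x t₁) (x t₂) ≤ M * |t₁ - t₂| := by
  rw [dist_eq_norm]
  exact (convex_Ici (0 : ℝ)).norm_image_sub_le_of_norm_hasDerivWithin_le (fun t ht ↦ hx.deriv t ht)
    (fun t ht ↦ hM _ (hx.mem t ht)) h₂ h₁

theorem norm_sub_euler_le (hx : IsForwardSolution f s x₀ x) (hf : LipschitzOnWith K f s)
    (hM : ∀ y ∈ s, ‖f y‖ ≤ M) (ht : 0 ≤ t) (hh : 0 ≤ h) :
    ‖x (t + h) - (x t + h • f (x t))‖ ≤ h ^ 2 * (K * M) := by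
  have hsub : Set.Icc t (t + h) ⊆ Set.Ici 0 := fun τ hτ ↦ ht.trans hτ.1
  have hderiv : ∀ τ ∈ Set.Icc t (t + h), HasDerivWithinAt (fun τ ↦ x τ - τ • f (x t))
      (f (x τ) - f (x t)) (Set.Icc t (t + h)) τ := fun τ hτ ↦ by
    simpa using ((hx.deriv τ (hsub hτ)).mono hsub).fun_sub
      ((hasDerivWithinAt_id τ _).smul_const (f (x t)))
  have hbound : ∀ τ ∈ Set.Icc t (t + h), ‖f (x τ) - f (x t)‖ ≤ K * (M * h) := fun τ hτ ↦ by
    have hM0 : 0 ≤ M := (norm_nonneg _).trans (hM _ (hx.mem t ht))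
    rw [← dist_eq_norm]
    refine (hf.dist_le_mul _ (hx.mem τ (hsub hτ)) _ (hx.mem t ht)).trans ?_
    gcongr
    refine (hx.dist_le_of_norm_le hM (hsub hτ) ht).trans ?_
    gcongr
    exact abs_le.2 ⟨by linarith [hτ.1], by linarith [hτ.2]⟩
  have hmain := (convex_Icc t (t + h)).norm_image_sub_le_of_norm_hasDerivWithin_le hderiv hbound
    (Set.left_mem_Icc.2 (by linarith)) (Set.right_mem_Icc.2 (by linarith))
  calc ‖x (t + h) - (x t + h • f (x t))‖
      = ‖x (t + h) - (t + h) • f (x t) - (x t - t • f (x t))‖ := by congr 1; module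
    _ ≤ K * (M * h) * ‖t + h - t‖ := hmain
    _ = h ^ 2 * (K * M) := by rw [add_sub_cancel_left, Real.norm_of_nonneg hh]; ring

theorem norm_oneStep_sub_le (hx : IsForwardSolution f s x₀ x) (hf : LipschitzOnWith K f s)
    (hM : ∀ y ∈ s, ‖f y‖ ≤ M) (hh : 0 ≤ h) {Φ : E → E}
    (hΦ : ∀ y ∈ s, ‖Φ y - (y + h • f y)‖ ≤ h ^ 2 * C) {y : E} (hy : y ∈ s) (ht : 0 ≤ t) :
    ‖Φ y - x (t + h)‖ ≤ (1 + h * K) * ‖y - x t‖ + h ^ 2 * (C + K * M) := by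
  have hlip : ‖h • (f y - f (x t))‖ ≤ h * (K * ‖y - x t‖) := by
    rw [norm_smul, Real.norm_of_nonneg hh]
    gcongr
    exact hf.norm_sub_le hy (hx.mem t ht)
  calc ‖Φ y - x (t + h)‖
      = ‖Φ y - (y + h • f y) - (x (t + h) - (x t + h • f (x t))) + (y - x t) +
          h • (f y - f (x t))‖ := by congr 1; module
    _ ≤ h ^ 2 * C + h ^ 2 * (K * M) + ‖y - x t‖ + h * (K * ‖y - x t‖) :=
        norm_add_le_of_le (norm_add_le_of_le
          (norm_sub_le_of_le (hΦ y hy) (hx.norm_sub_euler_le hf hM ht hh)) le_rfl) hlip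
    _ = (1 + h * K) * ‖y - x t‖ + h ^ 2 * (C + K * M) := by ring

theorem norm_iterate_sub_le (hx : IsForwardSolution f s x₀ x) (hf : LipschitzOnWith K f s)
    (hM : ∀ y ∈ s, ‖f y‖ ≤ M) (hC : 0 ≤ C) (hh : 0 ≤ h) {Φ : E → E} (hΦs : Set.MapsTo Φ s s)
    (hΦ : ∀ y ∈ s, ‖Φ y - (y + h • f y)‖ ≤ h ^ 2 * C) (n : ℕ) :
    ‖Φ^[n] x₀ - x (n * h)‖ ≤ n * h * (h * (C + K * M)) * Real.exp (n * h * K) := by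
  have hx₀ : x₀ ∈ s := hx.initial ▸ hx.mem 0 le_rfl
  have hM0 : 0 ≤ M := (norm_nonneg _).trans (hM _ hx₀)
  have hstep : ∀ k ≥ 0, ‖Φ^[k + 1] x₀ - x ((k + 1 : ℕ) * h)‖ ≤
      (1 + h * K) * ‖Φ^[k] x₀ - x (k * h)‖ + h ^ 2 * (C + K * M) := fun k _ ↦ by
    rw [Function.iterate_succ_apply', Nat.cast_add_one, add_one_mul]
    exact hx.norm_oneStep_sub_le hf hM hh hΦ (hΦs.iterate k hx₀) (by positivity)
  have hgronwall := discrete_gronwall (u := fun k ↦ ‖Φ^[k] x₀ - x (k * h)‖) (norm_nonneg _) hstep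
    (fun _ _ ↦ by positivity) (fun _ _ ↦ by positivity) n.zero_le
  calc ‖Φ^[n] x₀ - x (n * h)‖
      ≤ n * (h ^ 2 * (C + K * M)) * Real.exp (n * (h * K)) := by simpa [hx.initial] using hgronwall
    _ = n * h * (h * (C + K * M)) * Real.exp (n * h * K) := by ring_nf

theorem tendsto_iterate (hx : IsForwardSolution f s x₀ x) (hf : LipschitzOnWith K f s)
    (hM : ∀ y ∈ s, ‖f y‖ ≤ M) (hC : 0 ≤ C) {Φ : ℝ → E → E}
    (hΦs : ∀ᶠ h in 𝓝[>] 0, Set.MapsTo (Φ h) s s)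
    (hΦ : ∀ᶠ h in 𝓝[>] 0, ∀ y ∈ s, ‖Φ h y - (y + h • f y)‖ ≤ h ^ 2 * C) (ht : 0 ≤ t) :
    Tendsto (fun h ↦ (Φ h)^[⌊t / h⌋₊] x₀) (𝓝[>] 0) (𝓝 (x t)) := by
  have hM0 : 0 ≤ M := (norm_nonneg _).trans (hM _ (hx.mem 0 le_rfl))
  have hlim : Tendsto (fun h : ℝ ↦ t * (h * (C + K * M)) * Real.exp (t * K) + M * h)
      (𝓝[>] 0) (𝓝 0) :=
    (Continuous.tendsto' (by fun_prop) _ _ (by simp)).mono_left nhdsWithin_le_nhds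
  refine tendsto_iff_dist_tendsto_zero.2 (squeeze_zero' (.of_forall fun _ ↦ dist_nonneg) ?_ hlim)
  filter_upwards [hΦs, hΦ, self_mem_nhdsWithin] with h hs hΦ (hh : 0 < h)
  have hn : ⌊t / h⌋₊ * h ≤ t := (le_div_iff₀ hh).1 (Nat.floor_le (by positivity))
  have hn' : t < (⌊t / h⌋₊ + 1) * h := (div_lt_iff₀ hh).1 (Nat.lt_floor_add_one _)
  refine (dist_triangle _ (x (⌊t / h⌋₊ * h)) _).trans (add_le_add ?_ ?_)
  · rw [dist_eq_norm]
    refine (hx.norm_iterate_sub_le hf hM hC hh.le hs hΦ _).trans ?_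
    gcongr
  · refine (hx.dist_le_of_norm_le hM (by positivity) ht).trans ?_
    gcongr
    exact abs_le.2 ⟨by linarith, by linarith⟩

theorem tendsto_of_tendstoUniformlyOn {ι : Type*} {l : Filter ι} {f' : ι → E → E}
    {x' : ι → ℝ → E} (hx : IsForwardSolution f s x₀ x) (hf : LipschitzOnWith K f s)
    (hx' : ∀ i, IsForwardSolution (f' i) s x₀ (x' i)) (hlim : TendstoUniformlyOn f' f l s)
    (ht : 0 ≤ t) : Tendsto (fun i ↦ x' i t) l (𝓝 (x t)) := by
  have hbound (i : ι) {ε : ℝ} (hε : ∀ y ∈ s, dist (f' i y) (f y) ≤ ε) :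
      dist (x' i t) (x t) ≤ gronwallBound 0 K ε t := by
    have hsub {τ : ℝ} (hτ : τ ∈ Set.Ico 0 t) : Set.Ici τ ⊆ Set.Ici 0 := Set.Ici_subset_Ici.2 hτ.1
    simpa using dist_le_of_approx_trajectories_ODE_of_mem (v := fun _ ↦ f) (s := fun _ ↦ s)
      (εg := 0) (fun _ _ ↦ hf) ((hx' i).continuousOn.mono Set.Icc_subset_Ici_self)
      (fun τ hτ ↦ ((hx' i).deriv τ hτ.1).mono (hsub hτ)) (fun τ hτ ↦ hε _ ((hx' i).mem τ hτ.1))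
      (fun τ hτ ↦ (hx' i).mem τ hτ.1) (hx.continuousOn.mono Set.Icc_subset_Ici_self)
      (fun τ hτ ↦ (hx.deriv τ hτ.1).mono (hsub hτ)) (by simp) (fun τ hτ ↦ hx.mem τ hτ.1)
      (by rw [(hx' i).initial, hx.initial, dist_self]) t ⟨ht, le_rfl⟩
  refine Metric.tendsto_nhds.2 fun δ hδ ↦ ?_
  have hsmall : ∀ᶠ ε in 𝓝[>] 0, gronwallBound 0 K ε t < δ :=
    (((gronwallBound_continuous_ε 0 K t).tendsto' 0 0 (gronwallBound_ε0_δ0 _ _)).eventually_lt_const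
      hδ).filter_mono nhdsWithin_le_nhds
  obtain ⟨ε, hεδ, hε : 0 < ε⟩ := (hsmall.and self_mem_nhdsWithin).exists
  filter_upwards [Metric.tendstoUniformlyOn_iff.1 hlim ε hε] with i hi
  exact (hbound i fun y hy ↦ (dist_comm _ _).trans_le (hi y hy).le).trans_lt hεδ

end IsForwardSolution

end IntegralCurves

section ScalarEquation

variable {f : ℝ → ℝ} {a c : ℝ} {K : NNReal}

theorem exists_isForwardSolution_of_nonpos (hac : a ≤ c) (hf : LipschitzOnWith K f (Set.Icc a c))
    (hfa : f a = 0) (hf0 : ∀ y ∈ Set.Icc a c, f y ≤ 0) :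
    ∃ x, IsForwardSolution f (Set.Icc a c) c x := by
  set g : ℝ → ℝ := Set.IccExtend hac ((Set.Icc a c).domRestrict f) with hg
  have hgf {y : ℝ} (hy : y ∈ Set.Icc a c) : g y = f y := Set.IccExtend_of_mem _ _ hy
  have hgK : LipschitzWith K g := by
    simpa [hg, Set.IccExtend] using hf.to_restrict.comp (LipschitzWith.projIcc hac)
  have hgL (y : ℝ) : ‖g y‖ ≤ (K * (c - a).toNNReal : NNReal) := by
    have hp := (Set.projIcc a c hac y).2
    calc ‖g y‖ = dist (f (Set.projIcc a c hac y)) (f a) := by simp [hg, Set.IccExtend, hfa]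
      _ ≤ K * dist (Set.projIcc a c hac y : ℝ) a :=
        hf.dist_le_mul _ hp _ (Set.left_mem_Icc.2 hac)
      _ ≤ (K * (c - a).toNNReal : NNReal) := by
        rw [NNReal.coe_mul, Real.coe_toNNReal _ (sub_nonneg.2 hac), Real.dist_eq,
          abs_of_nonneg (sub_nonneg.2 hp.1)]
        gcongr
        exact hp.2
  obtain ⟨x, hx0, hx⟩ := exists_forall_hasDerivAt_of_lipschitzWith hgK hgL c
  have hanti : Antitone x := antitone_of_hasDerivAt_nonpos hx fun t ↦ hf0 _ (Subtype.mem _)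
  have hlower (t : ℝ) : a ≤ x t := by
    by_contra! hlt
    have hgt : g (x t) = 0 := by rw [hg, Set.IccExtend_of_le_left _ _ hlt.le]; exact hfa
    have hconst := ODE_solution_unique_univ (v := fun _ ↦ g) (s := fun _ ↦ Set.univ)
      (f := x) (g := fun _ ↦ x t) (t₀ := t) (fun _ ↦ hgK.lipschitzOnWith)
      (fun τ ↦ ⟨hx τ, trivial⟩) (fun τ ↦ ⟨hgt ▸ hasDerivAt_const τ (x t), trivial⟩) rfl
    exact (hlt.trans_le (hac.trans_eq (hx0.symm.trans (congrFun hconst 0)))).false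
  have hmem (t : ℝ) (ht : 0 ≤ t) : x t ∈ Set.Icc a c := ⟨hlower t, hx0 ▸ hanti ht⟩
  exact ⟨x, hx0, hmem, fun t ht ↦ hgf (hmem t ht) ▸ (hx t).hasDerivWithinAt⟩

namespace IsForwardSolution

variable {x₀ : ℝ} {x : ℝ → ℝ}

theorem antitoneOn {s : Set ℝ} (hx : IsForwardSolution f s x₀ x) (hf0 : ∀ y ∈ s, f y ≤ 0) :
    AntitoneOn x (Set.Ici 0) :=
  antitoneOn_of_hasDerivWithinAt_nonpos (convex_Ici 0) hx.continuousOn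
    (fun t ht ↦ (hx.deriv t (interior_subset ht)).mono interior_subset)
    (fun t ht ↦ hf0 _ (hx.mem t (interior_subset ht)))

theorem exists_sub_eq (hx : IsForwardSolution f (Set.Icc a c) x₀ x) {t : ℝ} (ht : 0 ≤ t) :
    ∃ τ ∈ Set.Ioo t (t + 1), f (x τ) = x (t + 1) - x t := by
  obtain ⟨τ, hτ, h⟩ := exists_hasDerivAt_eq_slope x (fun τ ↦ f (x τ)) (lt_add_one t)
    (hx.continuousOn.mono fun τ hτ ↦ ht.trans hτ.1)
    (fun τ hτ ↦ (hx.deriv τ (ht.trans hτ.1.le)).hasDerivAt (Ici_mem_nhds (ht.trans_lt hτ.1)))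
  exact ⟨τ, hτ, by simpa using h⟩

theorem tendsto_atTop (hx : IsForwardSolution f (Set.Icc a c) x₀ x)
    (hf : ContinuousOn f (Set.Icc a c)) (hfa : f a ≤ 0) (hf0 : ∀ y ∈ Set.Ioc a c, f y < 0) :
    Tendsto x atTop (𝓝 a) := by
  have hnonpos : ∀ y ∈ Set.Icc a c, f y ≤ 0 := fun y hy ↦
    hy.1.eq_or_lt.elim (fun h ↦ h ▸ hfa) fun h ↦ (hf0 y ⟨h, hy.2⟩).le
  obtain ⟨L, hL⟩ : ∃ L, Tendsto x atTop (𝓝 L) := by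
    have hanti : Antitone fun t : ℝ ↦ x (max 0 t) := fun s t hst ↦
      hx.antitoneOn hnonpos (le_max_left 0 s) (le_max_left 0 t) (max_le_max_left 0 hst)
    have hbdd : BddBelow (Set.range fun t : ℝ ↦ x (max 0 t)) :=
      ⟨a, by rintro _ ⟨t, rfl⟩; exact (hx.mem _ (le_max_left 0 t)).1⟩
    refine ⟨_, (tendsto_atTop_ciInf hanti hbdd).congr' ?_⟩
    filter_upwards [eventually_ge_atTop 0] with t ht using by rw [max_eq_right ht]
  have hLmem : L ∈ Set.Icc a c := isClosed_Icc.mem_of_tendsto hL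
    ((eventually_ge_atTop 0).mono hx.mem)
  have hzero : f L = 0 := by
    choose! τ hτ hfτ using fun t (ht : 0 ≤ t) ↦ hx.exists_sub_eq ht
    have hτ_atTop : Tendsto τ atTop atTop := tendsto_atTop_mono' _
      ((eventually_ge_atTop 0).mono fun t ht ↦ (hτ t ht).1.le) tendsto_id
    have hxτ : Tendsto (fun t ↦ x (τ t)) atTop (𝓝[Set.Icc a c] L) :=
      tendsto_nhdsWithin_iff.2 ⟨hL.comp hτ_atTop,
        (hτ_atTop.eventually_ge_atTop 0).mono fun t ht ↦ hx.mem _ ht⟩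
    have hincr : Tendsto (fun t ↦ x (t + 1) - x t) atTop (𝓝 0) := by
      simpa using (hL.comp (tendsto_atTop_add_const_right _ 1 tendsto_id)).sub hL
    exact tendsto_nhds_unique (((hf L hLmem).tendsto.comp hxτ).congr'
      ((eventually_ge_atTop 0).mono hfτ)) hincr
  obtain rfl | h := hLmem.1.eq_or_lt
  · exact hL
  · exact absurd hzero (hf0 L ⟨h, hLmem.2⟩).ne

end IsForwardSolution

end ScalarEquation

section DecayEquation

/-- The vector field of the scalar equation `r' = -r² (A r + B)` that governs the common factor `r`
by which the EnKF has contracted the values of `G̃`; for an ensemble, `A` is the variance of `G̃`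
and `A + B` is the covariance of `G̃` with the coordinate along which `G` varies. -/
def decayField (A B x : ℝ) : ℝ := -(x ^ 2 * (A * x + B))

/-- The update of the contraction factor in one EnKF step of size `h`: a semi-implicit Euler step
for `decayField`. -/
noncomputable def decayStep (A B h x : ℝ) : ℝ := x + h / (1 + h * (x ^ 2 * A)) * decayField A B x

/-- `r` is the contraction factor of the continuous-time EnKF: the solution of `r' = -r² (A r + B)`
started at `1`. -/
abbrev IsDecay (A B : ℝ) (r : ℝ → ℝ) : Prop :=
  IsForwardSolution (decayField A B) (Set.Icc 0 1) 1 r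

variable {A B x h t : ℝ}

theorem decayField_nonpos (hA : 0 ≤ A) (hB : 0 ≤ B) (hx : 0 ≤ x) : decayField A B x ≤ 0 :=
  neg_nonpos.2 (by positivity)

theorem decayField_neg (hA : 0 < A) (hB : 0 ≤ B) (hx : 0 < x) : decayField A B x < 0 :=
  neg_neg_of_pos (by positivity)

theorem norm_decayField_le (hA : 0 ≤ A) (hB : 0 ≤ B) (hx : x ∈ Set.Icc (0 : ℝ) 1) :
    ‖decayField A B x‖ ≤ A + B := by
  obtain ⟨h0, h1⟩ := hx
  rw [decayField, norm_neg, Real.norm_of_nonneg (by positivity)]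
  calc x ^ 2 * (A * x + B) ≤ 1 ^ 2 * (A * 1 + B) := by gcongr
    _ = A + B := by ring

theorem lipschitzOnWith_decayField (hA : 0 ≤ A) (hB : 0 ≤ B) :
    LipschitzOnWith (3 * A + 2 * B).toNNReal (decayField A B) (Set.Icc 0 1) := by
  refine LipschitzOnWith.of_dist_le_mul fun x ⟨hx0, hx1⟩ y ⟨hy0, hy1⟩ ↦ ?_
  have hfactor : decayField A B x - decayField A B y =
      -((A * (x ^ 2 + x * y + y ^ 2) + B * (x + y)) * (x - y)) := by
    unfold decayField; ring
  rw [Real.coe_toNNReal _ (by positivity), Real.dist_eq, Real.dist_eq, hfactor, abs_neg, abs_mul,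
    abs_of_nonneg (by positivity)]
  gcongr ?_ * _
  calc A * (x ^ 2 + x * y + y ^ 2) + B * (x + y)
      ≤ A * (1 ^ 2 + 1 * 1 + 1 ^ 2) + B * (1 + 1) := by gcongr
    _ = 3 * A + 2 * B := by ring

theorem tendstoUniformlyOn_decayField {ι : Type*} {l : Filter ι} {A' B' : ι → ℝ}
    (hA : Tendsto A' l (𝓝 A)) (hB : Tendsto B' l (𝓝 B)) :
    TendstoUniformlyOn (fun i ↦ decayField (A' i) (B' i)) (decayField A B) l (Set.Icc 0 1) := by
  refine Metric.tendstoUniformlyOn_iff.2 fun ε hε ↦ ?_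
  filter_upwards [Metric.tendsto_nhds.1 hA (ε / 2) (half_pos hε),
    Metric.tendsto_nhds.1 hB (ε / 2) (half_pos hε)] with i hAi hBi x ⟨h0, h1⟩
  have hdiff : decayField A B x - decayField (A' i) (B' i) x =
      x ^ 3 * (A' i - A) + x ^ 2 * (B' i - B) := by
    unfold decayField; ring
  calc dist (decayField A B x) (decayField (A' i) (B' i) x)
      ≤ |x ^ 3 * (A' i - A)| + |x ^ 2 * (B' i - B)| := by
        rw [Real.dist_eq, hdiff]; exact abs_add_le _ _
    _ ≤ |A' i - A| + |B' i - B| := by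
        rw [abs_mul, abs_mul, abs_of_nonneg (pow_nonneg h0 3), abs_of_nonneg (pow_nonneg h0 2)]
        exact add_le_add (mul_le_of_le_one_left (abs_nonneg _) (pow_le_one₀ h0 h1))
          (mul_le_of_le_one_left (abs_nonneg _) (pow_le_one₀ h0 h1))
    _ < ε := by rw [Real.dist_eq] at hAi hBi; linarith

theorem eventually_mul_lt_one (c : ℝ) : ∀ᶠ h : ℝ in 𝓝[>] 0, h * c < 1 :=
  ((continuous_mul_const c).tendsto' 0 0 (zero_mul _)).eventually_lt_const one_pos
    |>.filter_mono nhdsWithin_le_nhds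

theorem mapsTo_decayStep (hA : 0 ≤ A) (hB : 0 ≤ B) (hh : 0 ≤ h) (hhAB : h * (A + B) ≤ 1) :
    Set.MapsTo (decayStep A B h) (Set.Icc 0 1) (Set.Icc 0 1) := by
  rintro x ⟨h0, h1⟩
  have hfactor : decayStep A B h x = x * (1 - h / (1 + h * (x ^ 2 * A)) * (x * (A * x + B))) := by
    simp only [decayStep, decayField]; ring
  have hle : h / (1 + h * (x ^ 2 * A)) * (x * (A * x + B)) ≤ 1 :=
    calc h / (1 + h * (x ^ 2 * A)) * (x * (A * x + B)) ≤ h * (1 * (A * 1 + B)) := by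
          gcongr
          exact div_le_self hh (le_add_of_nonneg_right (by positivity))
      _ ≤ 1 := by linarith
  rw [hfactor]
  exact ⟨mul_nonneg h0 (sub_nonneg.2 hle),
    mul_le_one₀ h1 (sub_nonneg.2 hle) (sub_le_self _ (by positivity))⟩

theorem norm_decayStep_sub_euler_le (hA : 0 ≤ A) (hB : 0 ≤ B) (hh : 0 ≤ h)
    (hx : x ∈ Set.Icc (0 : ℝ) 1) :
    ‖decayStep A B h x - (x + h • decayField A B x)‖ ≤ h ^ 2 * (A * (A + B)) := by
  obtain ⟨h0, h1⟩ := id hx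
  have hdiff : decayStep A B h x - (x + h • decayField A B x) =
      -(h ^ 2 * (x ^ 2 * A) / (1 + h * (x ^ 2 * A)) * decayField A B x) := by
    rw [decayStep, smul_eq_mul]
    field_simp
    ring
  have hweight : h ^ 2 * (x ^ 2 * A) / (1 + h * (x ^ 2 * A)) ≤ h ^ 2 * A :=
    calc h ^ 2 * (x ^ 2 * A) / (1 + h * (x ^ 2 * A)) ≤ h ^ 2 * (x ^ 2 * A) :=
          div_le_self (by positivity) (le_add_of_nonneg_right (by positivity))
      _ ≤ h ^ 2 * (1 ^ 2 * A) := by gcongr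
      _ = h ^ 2 * A := by ring
  rw [hdiff, norm_neg, norm_mul, Real.norm_of_nonneg (by positivity),
    show h ^ 2 * (A * (A + B)) = h ^ 2 * A * (A + B) from (mul_assoc _ _ _).symm]
  exact mul_le_mul hweight (norm_decayField_le hA hB hx) (norm_nonneg _) (by positivity)

theorem exists_isDecay (hA : 0 ≤ A) (hB : 0 ≤ B) : ∃ r, IsDecay A B r :=
  exists_isForwardSolution_of_nonpos zero_le_one (lipschitzOnWith_decayField hA hB)
    (by simp [decayField]) fun _ hx ↦ decayField_nonpos hA hB hx.1

namespace IsDecay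

variable {r : ℝ → ℝ}

theorem tendsto_iterate_decayStep (hr : IsDecay A B r) (hA : 0 ≤ A) (hB : 0 ≤ B) (ht : 0 ≤ t) :
    Tendsto (fun h ↦ (decayStep A B h)^[⌊t / h⌋₊] 1) (𝓝[>] 0) (𝓝 (r t)) := by
  refine hr.tendsto_iterate (lipschitzOnWith_decayField hA hB)
    (fun _ ↦ norm_decayField_le hA hB) (C := A * (A + B)) (by positivity) ?_ ?_ ht
  · filter_upwards [eventually_mul_lt_one (A + B), self_mem_nhdsWithin] with h hs hh
    exact mapsTo_decayStep hA hB (Set.mem_Ioi.1 hh).le hs.le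
  · filter_upwards [self_mem_nhdsWithin] with h hh y
    exact norm_decayStep_sub_euler_le hA hB (Set.mem_Ioi.1 hh).le

theorem tendsto_of_tendsto {ι : Type*} {l : Filter ι} {A' B' : ι → ℝ} {r' : ι → ℝ → ℝ}
    (hr : IsDecay A B r) (hr' : ∀ i, IsDecay (A' i) (B' i) (r' i)) (hA : 0 ≤ A) (hB : 0 ≤ B)
    (hA' : Tendsto A' l (𝓝 A)) (hB' : Tendsto B' l (𝓝 B)) (ht : 0 ≤ t) :
    Tendsto (fun i ↦ r' i t) l (𝓝 (r t)) :=
  hr.tendsto_of_tendstoUniformlyOn (lipschitzOnWith_decayField hA hB) hr'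
    (tendstoUniformlyOn_decayField hA' hB') ht

theorem tendsto_zero (hr : IsDecay A B r) (hA : 0 < A) (hB : 0 ≤ B) :
    Tendsto r atTop (𝓝 0) :=
  hr.tendsto_atTop (lipschitzOnWith_decayField hA.le hB).continuousOn
    (decayField_nonpos hA.le hB le_rfl) fun _ hx ↦ decayField_neg hA hB hx.1

end IsDecay

end DecayEquation

section Covariance

variable {X : Type*} [MeasurableSpace X] {μ : Measure X} {f g : X → ℝ}

theorem covariance_eq_zero_of_variance_eq_zero [IsFiniteMeasure μ] (hf : MemLp f 2 μ)
    (h : Var[f; μ] = 0) (g : X → ℝ) : cov[f, g; μ] = 0 := by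
  refine integral_eq_zero_of_ae ?_
  filter_upwards [ae_eq_integral_of_variance_eq_zero hf h] with x hx
  simp [hx]

theorem memLp_max_zero {p : ENNReal} (hf : MemLp f p μ) : MemLp (fun x ↦ max 0 (f x)) p μ := by
  simpa only [max_comm] using hf.pos_part

theorem variance_max_zero_le_covariance [IsZeroOrProbabilityMeasure μ] (hf : MemLp f 2 μ) :
    Var[fun x ↦ max 0 (f x); μ] ≤ cov[fun x ↦ max 0 (f x), f; μ] := by
  obtain rfl | _ := eq_zero_or_isProbabilityMeasure μ
  · simp
  have hmax := memLp_max_zero hf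
  have hprod : ∀ x, max 0 (f x) * (f x - max 0 (f x)) = 0 := fun x ↦ by
    obtain h | h := max_choice 0 (f x) <;> rw [h] <;> ring
  rw [← sub_nonneg, ← covariance_self hmax.aemeasurable, ← covariance_fun_sub_right hmax hf hmax,
    covariance_eq_sub hmax (Y := fun x ↦ f x - max 0 (f x)) (hf.sub hmax)]
  simp only [Pi.mul_apply, hprod, integral_zero, zero_sub, Left.nonneg_neg_iff]
  exact mul_nonpos_of_nonneg_of_nonpos (integral_nonneg fun x ↦ le_max_left _ _)
    (integral_nonpos fun x ↦ sub_nonpos.2 (le_max_right _ _))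

end Covariance

section Empirical

variable {X : Type*} [MeasurableSpace X] {J : ℕ}

/-- The empirical measure of an ensemble, through which ensemble averages, variances and covariances
become those of Mathlib. It is `0` if `J = 0`. -/
noncomputable def empirical (v : Fin J → X) : Measure X := (uniformOn Set.univ).map v

instance (v : Fin J → X) : IsZeroOrProbabilityMeasure (empirical v) :=
  inferInstanceAs (IsZeroOrProbabilityMeasure ((uniformOn Set.univ).map v))

instance [NeZero J] (v : Fin J → X) : IsProbabilityMeasure (empirical v) :=
  Measure.isProbabilityMeasure_map (measurable_of_finite v).aemeasurable

theorem map_empirical {Y : Type*} [MeasurableSpace Y] {φ : X → Y} (hφ : Measurable φ)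
    (v : Fin J → X) : (empirical v).map φ = empirical fun k ↦ φ (v k) :=
  Measure.map_map hφ (measurable_of_finite v)

theorem memLp_empirical {E : Type*} [NormedAddCommGroup E] {f : X → E} (hf : StronglyMeasurable f)
    (p : ENNReal) (v : Fin J → X) : MemLp f p (empirical v) :=
  (memLp_map_measure_iff hf.aestronglyMeasurable (measurable_of_finite v).aemeasurable).2
    .of_discrete

theorem integral_empirical {E : Type*} [NormedAddCommGroup E] [NormedSpace ℝ E] [CompleteSpace E]
    {f : X → E} (hf : StronglyMeasurable f) (v : Fin J → X) :
    ∫ x, f x ∂empirical v = avg fun k ↦ f (v k) := by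
  rw [empirical, integral_map (measurable_of_finite v).aemeasurable hf.aestronglyMeasurable,
    integral_fintype .of_finite]
  simp [avg, measureReal_def, uniformOn_univ, Finset.smul_sum]

end Empirical

section EnsembleCovariance

variable {d J : ℕ} {g : Space d → ℝ}

theorem avg_apply (f : Fin J → Space d) (i : Fin d) : avg f i = avg fun k ↦ f k i := by
  simp [avg]

theorem memLp_apply {ν : Measure (Space d)} {p : ENNReal} (hν : MemLp id p ν) (i : Fin d) :
    MemLp (fun x ↦ x i) p ν :=
  hν.eval_piLp i

theorem memLp_id_empirical (u : Fin J → Space d) (p : ENNReal) : MemLp id p (empirical u) :=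
  memLp_empirical stronglyMeasurable_id p u

theorem covPP_eq_variance (hg : Measurable g) (u : Fin J → Space d) :
    covPP g u = Var[g; empirical u] := by
  rw [variance_eq_integral hg.aemeasurable, integral_empirical hg.stronglyMeasurable,
    integral_empirical (by fun_prop), covPP]

theorem covUP_apply (hg : Measurable g) (u : Fin J → Space d) (i : Fin d) :
    covUP g u i = cov[g, fun x ↦ x i; empirical u] := by
  have hi : Measurable fun x : Space d ↦ x i := by fun_prop
  rw [covariance, integral_empirical hg.stronglyMeasurable,
    integral_empirical hi.stronglyMeasurable, integral_empirical (by fun_prop)]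
  simp only [covUP, avg_apply, PiLp.smul_apply, PiLp.sub_apply, smul_eq_mul]

end EnsembleCovariance

section Contraction

variable {d : ℕ} [NeZero d] {b : ℝ} {e : Space d} {ρ : ℝ}

theorem continuous_aux_affineLSF : Continuous (aux (affineLSF d b)) := by
  unfold aux affineLSF
  fun_prop

theorem measurable_aux_affineLSF : Measurable (aux (affineLSF d b)) :=
  continuous_aux_affineLSF.measurable

/-- The map that moves points along `e` so that the values of `G̃` shrink by the factor `ρ`. -/
noncomputable def contraction (b : ℝ) (e : Space d) (ρ : ℝ) (x : Space d) : Space d :=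
  x - ((1 - ρ) * aux (affineLSF d b) x) • e

theorem contraction_one (x : Space d) : contraction b e 1 x = x := by simp [contraction]

theorem continuous_contraction : Continuous (contraction b e ρ) := by
  have := continuous_aux_affineLSF (d := d) (b := b)
  unfold contraction
  fun_prop

theorem aux_contraction (he : e 0 = 1) (hρ : 0 ≤ ρ) (x : Space d) :
    aux (affineLSF d b) (contraction b e ρ x) = ρ * aux (affineLSF d b) x := by
  simp only [contraction, aux, affineLSF, PiLp.sub_apply, PiLp.smul_apply, he, smul_eq_mul, mul_one]
  obtain h | h := le_total 0 (x 0 - b)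
  · rw [max_eq_right h, max_eq_right (by nlinarith)]; ring
  · rw [max_eq_left h, max_eq_left (by linarith)]; ring

end Contraction

section Slope

variable {d : ℕ} [NeZero d] {b : ℝ} {ν : Measure (Space d)}

/-- The variance of `G̃` under `ν`, the coefficient `A` of the decay equation. -/
noncomputable def slope (b : ℝ) (ν : Measure (Space d)) : ℝ := Var[aux (affineLSF d b); ν]

/-- The covariance of `G̃` and `u₁ - G̃` under `ν`, the coefficient `B` of the decay equation. -/
noncomputable def intercept (b : ℝ) (ν : Measure (Space d)) : ℝ :=
  cov[aux (affineLSF d b), fun x ↦ x 0; ν] - slope b ν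

/-- `e` is the direction of `Cov(G̃, u)` under `ν`, normalized such that `G` grows at unit rate
along it. -/
structure IsDirection (b : ℝ) (ν : Measure (Space d)) (e : Space d) : Prop where
  apply_zero : e 0 = 1
  covariance_eq : ∀ i, cov[aux (affineLSF d b), fun x ↦ x i; ν] =
    cov[aux (affineLSF d b), fun x ↦ x 0; ν] * e i

theorem slope_nonneg : 0 ≤ slope b ν := variance_nonneg _ _

theorem slope_add_intercept :
    slope b ν + intercept b ν = cov[aux (affineLSF d b), fun x ↦ x 0; ν] :=
  add_sub_cancel _ _

theorem IsDirection.tendsto {ι : Type*} {l : Filter ι} {ν' : ι → Measure (Space d)}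
    {e' : ι → Space d} {e : Space d} (he' : ∀ i, IsDirection b (ν' i) (e' i))
    (he : IsDirection b ν e) (h0 : cov[aux (affineLSF d b), fun x ↦ x 0; ν] ≠ 0)
    (hcov : ∀ k, Tendsto (fun i ↦ cov[aux (affineLSF d b), fun x ↦ x k; ν' i]) l
      (𝓝 cov[aux (affineLSF d b), fun x ↦ x k; ν])) : Tendsto e' l (𝓝 e) := by
  refine ((PiLp.continuous_toLp 2 _).tendsto _).comp (tendsto_pi_nhds.2 fun k ↦ ?_)
  have hlim := (hcov k).div (hcov 0) h0
  rw [he.covariance_eq k, mul_div_cancel_left₀ _ h0] at hlim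
  refine hlim.congr' ?_
  filter_upwards [(hcov 0).eventually_ne h0] with i hi
  rw [Pi.div_apply, (he' i).covariance_eq k, mul_div_cancel_left₀ _ hi]

variable [IsZeroOrProbabilityMeasure ν]

theorem memLp_affineLSF {p : ENNReal} (hν : MemLp id p ν) : MemLp (affineLSF d b) p ν :=
  (memLp_apply hν 0).sub (memLp_const b)

theorem memLp_aux_affineLSF {p : ENNReal} (hν : MemLp id p ν) :
    MemLp (aux (affineLSF d b)) p ν :=
  memLp_max_zero (memLp_affineLSF hν)

theorem integrable_aux_affineLSF (hν : Integrable id ν) : Integrable (aux (affineLSF d b)) ν :=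
  memLp_one_iff_integrable.1 (memLp_aux_affineLSF (memLp_one_iff_integrable.2 hν))

theorem integral_contraction (hν : Integrable id ν) (e : Space d) (ρ : ℝ) :
    ∫ x, contraction b e ρ x ∂ν =
      ∫ x, x ∂ν - ((1 - ρ) * ∫ x, aux (affineLSF d b) x ∂ν) • e := by
  unfold contraction
  rw [integral_sub (f := fun x ↦ x) hν
      (((integrable_aux_affineLSF hν).const_mul (1 - ρ)).smul_const e),
    integral_smul_const, integral_const_mul]

theorem intercept_nonneg (hν : MemLp id 2 ν) : 0 ≤ intercept b ν := by
  have h := variance_max_zero_le_covariance (memLp_affineLSF (b := b) hν)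
  obtain rfl | _ := eq_zero_or_isProbabilityMeasure ν
  · simp [intercept, slope]
  rw [intercept, sub_nonneg, slope]
  exact h.trans_eq
    (covariance_sub_const_right ((memLp_apply hν 0).integrable one_le_two) b)

theorem exists_isDirection (hν : MemLp id 2 ν) : ∃ e, IsDirection b ν e := by
  by_cases h : cov[aux (affineLSF d b), fun x ↦ x 0; ν] = 0
  · have hvar : slope b ν = 0 := by
      linarith [slope_add_intercept (b := b) (ν := ν), slope_nonneg (b := b) (ν := ν),
        intercept_nonneg (b := b) hν]
    have hcov := covariance_eq_zero_of_variance_eq_zero (memLp_aux_affineLSF hν) hvar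
    exact ⟨EuclideanSpace.single 0 1, by simp, fun i ↦ by simp [hcov]⟩
  · refine ⟨WithLp.toLp 2 fun i ↦ cov[aux (affineLSF d b), fun x ↦ x i; ν] /
      cov[aux (affineLSF d b), fun x ↦ x 0; ν], div_self h, fun i ↦ ?_⟩
    exact (mul_div_cancel₀ _ h).symm

end Slope

section EnsembleFlow

variable {d J : ℕ} [NeZero d] {b : ℝ} {u : Fin J → Space d} {e : Space d} {ρ h : ℝ}

theorem covPP_contraction (he : e 0 = 1) (hρ : 0 ≤ ρ) :
    covPP (aux (affineLSF d b)) (fun j ↦ contraction b e ρ (u j)) =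
      ρ ^ 2 * slope b (empirical u) := by
  have hm : Measurable (contraction b e ρ) := continuous_contraction.measurable
  rw [covPP_eq_variance measurable_aux_affineLSF, ← map_empirical hm,
    variance_map measurable_aux_affineLSF.aemeasurable hm.aemeasurable]
  simp only [Function.comp_def, aux_contraction he hρ]
  exact variance_const_mul _ _ _

theorem covUP_contraction (he : IsDirection b (empirical u) e) (hρ : 0 ≤ ρ) :
    covUP (aux (affineLSF d b)) (fun j ↦ contraction b e ρ (u j)) =
      (ρ * (slope b (empirical u) * ρ + intercept b (empirical u))) • e := by
  have hm : Measurable (contraction b e ρ) := continuous_contraction.measurable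
  have hG : MemLp (aux (affineLSF d b)) 2 (empirical u) :=
    memLp_aux_affineLSF (memLp_id_empirical u 2)
  ext i
  rw [covUP_apply measurable_aux_affineLSF, ← map_empirical hm,
    covariance_map_fun measurable_aux_affineLSF.aestronglyMeasurable
      (by fun_prop) hm.aemeasurable]
  simp only [aux_contraction he.apply_zero hρ]
  simp only [contraction, PiLp.sub_apply, PiLp.smul_apply, smul_eq_mul]
  rw [covariance_const_mul_left,
    covariance_fun_sub_right hG (memLp_apply (memLp_id_empirical u 2) i)
      ((hG.const_mul _).mul_const _), covariance_mul_const_right, covariance_const_mul_right,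
    covariance_self hG.aemeasurable, ← slope, he.covariance_eq, ← slope_add_intercept]
  ring

theorem step_contraction (he : IsDirection b (empirical u) e) (hρ : 0 ≤ ρ) (hh : 0 < h) :
    step (affineLSF d b) h (fun j ↦ contraction b e ρ (u j)) = fun j ↦ contraction b e
      (decayStep (slope b (empirical u)) (intercept b (empirical u)) h ρ) (u j) := by
  ext1 j
  have hA : 0 ≤ slope b (empirical u) := slope_nonneg
  have hinv : (ρ ^ 2 * slope b (empirical u) + 1 / h)⁻¹ =
      h / (1 + h * (ρ ^ 2 * slope b (empirical u))) := by
    field_simp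
    ring
  rw [step, covUP_contraction he hρ, covPP_contraction he.apply_zero hρ,
    aux_contraction he.apply_zero hρ, hinv, contraction, contraction, decayStep, decayField]
  module

theorem iter_eq_contraction (he : IsDirection b (empirical u) e) (hh : 0 < h)
    (hsmall : h * (slope b (empirical u) + intercept b (empirical u)) ≤ 1) (n : ℕ) :
    iter (affineLSF d b) h u n = fun j ↦ contraction b e
      ((decayStep (slope b (empirical u)) (intercept b (empirical u)) h)^[n] 1) (u j) := by
  induction n with
  | zero => ext1 j; exact (contraction_one _).symm
  | succ n ih =>
    have hmem := (mapsTo_decayStep slope_nonneg (intercept_nonneg (memLp_id_empirical u 2)) hh.le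
      hsmall).iterate n (Set.right_mem_Icc.2 zero_le_one)
    rw [iter] at ih ⊢
    rw [Function.iterate_succ_apply', Function.iterate_succ_apply', ih,
      step_contraction he hmem.1 hh]

theorem avg_flow_contraction (he : IsDirection b (empirical u) e) (hρ : 0 ≤ ρ) (j : Fin J) :
    (avg fun k ↦ ((aux (affineLSF d b) (contraction b e ρ (u k)) -
        avg fun i ↦ aux (affineLSF d b) (contraction b e ρ (u i))) *
          -aux (affineLSF d b) (contraction b e ρ (u j))) •
        (contraction b e ρ (u k) - avg fun i ↦ contraction b e ρ (u i))) =
      (decayField (slope b (empirical u)) (intercept b (empirical u)) ρ *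
        aux (affineLSF d b) (u j)) • e :=
  calc _ = -aux (affineLSF d b) (contraction b e ρ (u j)) •
        covUP (aux (affineLSF d b)) (fun j ↦ contraction b e ρ (u j)) := by
        simp only [covUP, avg, Finset.smul_sum, smul_smul]
        congr! 2
        ring
    _ = _ := by
      rw [covUP_contraction he hρ, aux_contraction he.apply_zero hρ, smul_smul, decayField]
      congr 1
      ring

theorem isContinuousTimeLimit_contraction (he : IsDirection b (empirical u) e) {r : ℝ → ℝ}
    (hr : IsDecay (slope b (empirical u)) (intercept b (empirical u)) r) :
    IsContinuousTimeLimit (affineLSF d b) u fun t j ↦ contraction b e (r t) (u j) where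
  initial := by simp only [hr.initial, contraction_one]
  flow t ht j := by
    rw [avg_flow_contraction he (hr.mem t ht).1]
    have hderiv := ((((hr.deriv t ht).const_sub 1).mul_const
      (aux (affineLSF d b) (u j))).smul_const e).const_sub (u j)
    rwa [neg_mul, neg_smul, neg_neg] at hderiv
  limit t ht := by
    have hB : 0 ≤ intercept b (empirical u) := intercept_nonneg (memLp_id_empirical u 2)
    have hcont : Continuous fun ρ j ↦ contraction b e ρ (u j) := by
      unfold contraction
      fun_prop
    refine ((hcont.tendsto _).comp (hr.tendsto_iterate_decayStep slope_nonneg hB ht)).congr' ?_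
    filter_upwards [eventually_mul_lt_one (slope b (empirical u) + intercept b (empirical u)),
      self_mem_nhdsWithin] with h hsmall hh
    exact (iter_eq_contraction he hh hsmall.le _).symm

end EnsembleFlow

section WeakConvergence

open TopologicalSpace

theorem exists_countable_isPiSystem_nhds (X : Type*) [TopologicalSpace X]
    [SecondCountableTopology X] : ∃ S : Set (Set X), S.Countable ∧ IsPiSystem S ∧
      (∀ s ∈ S, IsOpen s) ∧ ∀ u, IsOpen u → ∀ x ∈ u, ∃ s ∈ S, s ∈ 𝓝 x ∧ s ⊆ u := by
  refine ⟨Set.sInter '' {t | t.Finite ∧ t ⊆ countableBasis X},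
    (Set.countable_ofPred_finite_subset (countable_countableBasis X)).image _, ?_, ?_, ?_⟩
  · rintro _ ⟨t, ⟨hfin, ht⟩, rfl⟩ _ ⟨t', ⟨hfin', ht'⟩, rfl⟩ _
    exact ⟨t ∪ t', ⟨hfin.union hfin', Set.union_subset ht ht'⟩, Set.sInter_union t t'⟩
  · rintro _ ⟨t, ⟨hfin, ht⟩, rfl⟩
    exact hfin.isOpen_sInter fun s hs ↦ isOpen_of_mem_countableBasis (ht hs)
  · intro u hu x hx
    obtain ⟨s, hs, hxs, hsu⟩ := (isBasis_countableBasis X).exists_subset_of_mem_open hx hu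
    exact ⟨s, ⟨{s}, ⟨Set.finite_singleton s, by simpa using hs⟩, by simp⟩,
      (isOpen_of_mem_countableBasis hs).mem_nhds hxs, hsu⟩

theorem tendsto_map_of_tendsto_of_tendsto {X Y Z ι : Type*} {l : Filter ι}
    [TopologicalSpace X] [PseudoMetrizableSpace X] [SecondCountableTopology X]
    [MeasurableSpace X] [OpensMeasurableSpace X]
    [TopologicalSpace Y] [PseudoMetrizableSpace Y] [SecondCountableTopology Y]
    [MeasurableSpace Y] [OpensMeasurableSpace Y]
    [TopologicalSpace Z] [MeasurableSpace Z] [BorelSpace Z]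
    {μ : ι → ProbabilityMeasure X} {ν : ProbabilityMeasure X} {y : ι → Y} {y₀ : Y}
    (hμ : Tendsto μ l (𝓝 ν)) (hy : Tendsto y l (𝓝 y₀)) {F : X → Y → Z}
    (hF : Continuous (Function.uncurry F)) :
    Tendsto (fun i ↦ (μ i).map (f := fun x ↦ F x (y i))
        (hF.comp (.prodMk_left (y i))).measurable.aemeasurable) l
      (𝓝 (ν.map (f := fun x ↦ F x y₀)
        (hF.comp (.prodMk_left y₀)).measurable.aemeasurable)) := by
  have hprod : ∀ (ρ : ProbabilityMeasure X) (z : Y),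
      (ρ.prod (diracProba z)).map hF.measurable.aemeasurable = ρ.map (f := fun x ↦ F x z)
        (hF.comp (.prodMk_left z)).measurable.aemeasurable := fun ρ z ↦ Subtype.ext <| by
    change ((ρ : Measure X).prod (Measure.dirac z)).map _ = (ρ : Measure X).map _
    rw [Measure.prod_dirac, Measure.map_map hF.measurable measurable_prodMk_right]
    rfl
  simp only [← hprod]
  exact ProbabilityMeasure.tendsto_map_of_tendsto_of_continuous _ _
    ((ProbabilityMeasure.continuous_prod.tendsto _).comp
      (hμ.prodMk_nhds ((continuous_diracProba.tendsto _).comp hy))) hF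

/-- The empirical measure of a nonempty ensemble, as a point of the space of probability measures
with the weak topology. -/
noncomputable def empiricalProba {X : Type*} [MeasurableSpace X] {J : ℕ} [NeZero J]
    (v : Fin J → X) : ProbabilityMeasure X :=
  ⟨empirical v, inferInstance⟩

theorem coe_empiricalProba {X : Type*} [MeasurableSpace X] {J : ℕ} [NeZero J] (v : Fin J → X) :
    (empiricalProba v : Measure X) = empirical v := rfl

theorem forall_tendsto_avg_iff {X : Type*} [TopologicalSpace X] [MeasurableSpace X]
    [OpensMeasurableSpace X] {v : (J : ℕ) → Fin J → X} {μ : ProbabilityMeasure X} :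
    (∀ f : BoundedContinuousFunction X ℝ, Tendsto (fun J ↦ avg fun j ↦ f (v J j)) atTop
      (𝓝 (∫ x, f x ∂(μ : Measure X)))) ↔
    Tendsto (fun J ↦ empiricalProba (v (J + 1))) atTop (𝓝 μ) := by
  rw [ProbabilityMeasure.tendsto_iff_forall_integral_tendsto]
  refine forall_congr' fun f ↦ ?_
  rw [← tendsto_add_atTop_iff_nat 1]
  simp only [coe_empiricalProba, integral_empirical f.continuous.stronglyMeasurable]

end WeakConvergence

section LawOfLargeNumbers

variable {X Ω : Type*} [MeasurableSpace X] [MeasurableSpace Ω] {P : Measure Ω} {U : ℕ → Ω → X}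
  {γ : Measure X}

theorem ae_tendsto_avg_comp {E : Type*} [NormedAddCommGroup E] [NormedSpace ℝ E] [CompleteSpace E]
    [MeasurableSpace E] [BorelSpace E] (hlaw : ∀ j, HasLaw (U j) γ P)
    (hindep : Pairwise fun i j ↦ U i ⟂ᵢ[P] U j) {φ : X → E} (hφ : Measurable φ)
    (hφγ : Integrable φ γ) :
    ∀ᵐ ω ∂P, Tendsto (fun J ↦ avg fun k : Fin J ↦ φ (U k ω)) atTop (𝓝 (∫ x, φ x ∂γ)) := by
  have hint : Integrable (φ ∘ U 0) P := by
    rw [← (hlaw 0).map_eq] at hφγ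
    exact hφγ.comp_aemeasurable (hlaw 0).aemeasurable
  have hslln := strong_law_ae (μ := P) (fun j ↦ φ ∘ U j) hint
    (fun i j hij ↦ (hindep hij).comp hφ hφ)
    (fun i ↦ ((hlaw i).identDistrib (hlaw 0)).comp hφ)
  rw [(hlaw 0).integral_comp hφγ.aestronglyMeasurable] at hslln
  filter_upwards [hslln] with ω hω
  simpa only [avg, Fin.sum_univ_eq_sum_range (fun k ↦ φ (U k ω))] using! hω

theorem ae_tendsto_covariance_empirical [IsProbabilityMeasure γ] (hlaw : ∀ j, HasLaw (U j) γ P)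
    (hindep : Pairwise fun i j ↦ U i ⟂ᵢ[P] U j) {f g : X → ℝ} (hf : Measurable f)
    (hg : Measurable g) (hfγ : MemLp f 2 γ) (hgγ : MemLp g 2 γ) :
    ∀ᵐ ω ∂P, Tendsto (fun J ↦ cov[f, g; empirical fun k : Fin J ↦ U k ω]) atTop
      (𝓝 cov[f, g; γ]) := by
  filter_upwards [ae_tendsto_avg_comp hlaw hindep hf (hfγ.integrable one_le_two),
    ae_tendsto_avg_comp hlaw hindep hg (hgγ.integrable one_le_two),
    ae_tendsto_avg_comp hlaw hindep (hf.mul hg) (hfγ.integrable_mul hgγ)] with ω hlim hlim' hlim''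
  rw [covariance_eq_sub hfγ hgγ]
  refine (hlim''.sub (hlim.mul hlim')).congr' ?_
  filter_upwards [eventually_ne_atTop 0] with J hJ
  have : NeZero J := ⟨hJ⟩
  rw [covariance_eq_sub (memLp_empirical hf.stronglyMeasurable 2 _)
    (memLp_empirical hg.stronglyMeasurable 2 _), integral_empirical hf.stronglyMeasurable,
    integral_empirical hg.stronglyMeasurable, integral_empirical (hf.mul hg).stronglyMeasurable]

theorem ae_forall_tendsto_avg [TopologicalSpace X] [SecondCountableTopology X]
    [OpensMeasurableSpace X] [IsProbabilityMeasure γ] (hlaw : ∀ j, HasLaw (U j) γ P)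
    (hindep : Pairwise fun i j ↦ U i ⟂ᵢ[P] U j) :
    ∀ᵐ ω ∂P, ∀ f : BoundedContinuousFunction X ℝ,
      Tendsto (fun J ↦ avg fun k : Fin J ↦ f (U k ω)) atTop (𝓝 (∫ x, f x ∂γ)) := by
  obtain ⟨S, hcount, hpi, hopen, hnhds⟩ := exists_countable_isPiSystem_nhds X
  have hS : ∀ᵐ ω ∂P, ∀ s ∈ S,
      Tendsto (fun J ↦ avg fun k : Fin J ↦ s.indicator (1 : X → ℝ) (U k ω)) atTop
        (𝓝 (∫ x, s.indicator 1 x ∂γ)) :=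
    (ae_ball_iff hcount).2 fun s hs ↦ ae_tendsto_avg_comp hlaw hindep
      (measurable_one.indicator (hopen s hs).measurableSet)
      ((integrable_const (1 : ℝ)).indicator (hopen s hs).measurableSet)
  filter_upwards [hS] with ω hω
  refine forall_tendsto_avg_iff (μ := ⟨γ, inferInstance⟩).2 <|
    hpi.tendsto_probabilityMeasure_of_tendsto_of_mem (fun s hs ↦ (hopen s hs).measurableSet)
      hnhds fun s hs ↦ ?_
  have hlim := (tendsto_add_atTop_iff_nat 1).2 (hω s hs)
  have hmeas := (hopen s hs).measurableSet
  simp_rw [← integral_empirical (stronglyMeasurable_one.indicator hmeas),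
    integral_indicator_one hmeas] at hlim
  rw [← NNReal.tendsto_coe]
  exact hlim

end LawOfLargeNumbers

section MeanField

variable {d : ℕ} [NeZero d] {b : ℝ} {γ : Measure (Space d)} [IsProbabilityMeasure γ]

/-- The image of the initial law `γ` under `contraction b e ρ`, the large-ensemble limit of the EnKF
at the time at which it has contracted the values of `G̃` by `ρ`. -/
noncomputable def contractedLaw (b : ℝ) (e : Space d) (ρ : ℝ) (γ : Measure (Space d))
    [IsProbabilityMeasure γ] : ProbabilityMeasure (Space d) :=
  ⟨γ.map (contraction b e ρ),
    Measure.isProbabilityMeasure_map continuous_contraction.measurable.aemeasurable⟩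

theorem coe_contractedLaw (e : Space d) (ρ : ℝ) :
    (contractedLaw b e ρ γ : Measure (Space d)) = γ.map (contraction b e ρ) := rfl

theorem integral_id_contractedLaw (hγ : Integrable id γ) (e : Space d) (ρ : ℝ) :
    ∫ x, x ∂(contractedLaw b e ρ γ : Measure (Space d)) =
      ∫ x, x ∂γ - ((1 - ρ) * ∫ x, aux (affineLSF d b) x ∂γ) • e := by
  rw [coe_contractedLaw, integral_map (f := fun x ↦ x)
    continuous_contraction.measurable.aemeasurable aestronglyMeasurable_id,
    integral_contraction hγ]

/-- The properties of a sample from `γ` that hold almost surely and determine the large-ensemble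
limit of the EnKF started from it. -/
structure IsTypical (b : ℝ) (γ : Measure (Space d)) [IsProbabilityMeasure γ] (x : ℕ → Space d) :
    Prop extends IsLargeEnsembleLimit (fun _ k ↦ x k) ⟨γ, inferInstance⟩ where
  tendsto_mean_aux : Tendsto (fun J ↦ avg fun k : Fin J ↦ aux (affineLSF d b) (x k)) atTop
    (𝓝 (∫ y, aux (affineLSF d b) y ∂γ))
  tendsto_slope : Tendsto (fun J ↦ slope b (empirical fun k : Fin J ↦ x k)) atTop (𝓝 (slope b γ))
  tendsto_covariance : ∀ i, Tendsto
    (fun J ↦ cov[aux (affineLSF d b), fun y ↦ y i; empirical fun k : Fin J ↦ x k]) atTop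
    (𝓝 cov[aux (affineLSF d b), fun y ↦ y i; γ])

theorem ae_isTypical {Ω : Type*} [MeasurableSpace Ω] {P : Measure Ω} {U : ℕ → Ω → Space d}
    (hγ : MemLp id 2 γ) (hlaw : ∀ j, HasLaw (U j) γ P)
    (hindep : Pairwise fun i j ↦ U i ⟂ᵢ[P] U j) :
    ∀ᵐ ω ∂P, IsTypical b γ fun j ↦ U j ω := by
  have haux := measurable_aux_affineLSF (d := d) (b := b)
  have hauxγ := memLp_aux_affineLSF (b := b) hγ
  have hint := hγ.integrable one_le_two
  filter_upwards [ae_forall_tendsto_avg hlaw hindep,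
    ae_tendsto_avg_comp hlaw hindep measurable_id hint,
    ae_tendsto_avg_comp hlaw hindep haux (hauxγ.integrable one_le_two),
    ae_tendsto_covariance_empirical hlaw hindep haux haux hauxγ hauxγ,
    ae_all_iff.2 fun i : Fin d ↦ ae_tendsto_covariance_empirical hlaw hindep haux
      (by fun_prop) hauxγ (memLp_apply hγ i)] with ω hweak hmean hmean_aux hvar hcov
  simp only [covariance_self haux.aemeasurable] at hvar
  exact ⟨⟨hweak, hint, hmean⟩, hmean_aux, hvar, hcov⟩

namespace IsTypical

variable {x : ℕ → Space d}

theorem tendsto_intercept (hx : IsTypical b γ x) :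
    Tendsto (fun J ↦ intercept b (empirical fun k : Fin J ↦ x k)) atTop
      (𝓝 (intercept b γ)) :=
  (hx.tendsto_covariance 0).sub hx.tendsto_slope

theorem tendsto_empiricalProba_contraction (hx : IsTypical b γ x) {e : ℕ → Space d} {e₀ : Space d}
    (he : Tendsto e atTop (𝓝 e₀)) {ρ : ℕ → ℝ} {ρ₀ : ℝ} (hρ : Tendsto ρ atTop (𝓝 ρ₀)) :
    Tendsto (fun J ↦ empiricalProba fun k : Fin (J + 1) ↦
      contraction b (e (J + 1)) (ρ (J + 1)) (x k)) atTop (𝓝 (contractedLaw b e₀ ρ₀ γ)) := by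
  have hcont : Continuous
      (Function.uncurry fun (x : Space d) (y : Space d × ℝ) ↦ contraction b y.1 y.2 x) := by
    have := continuous_aux_affineLSF (d := d) (b := b)
    unfold contraction Function.uncurry
    fun_prop
  refine (tendsto_map_of_tendsto_of_tendsto (forall_tendsto_avg_iff.1 hx.weak)
    ((tendsto_add_atTop_iff_nat 1).2 (he.prodMk_nhds hρ)) hcont).congr fun J ↦ Subtype.ext ?_
  exact map_empirical continuous_contraction.measurable _

theorem isLargeEnsembleLimit (hx : IsTypical b γ x) {e : ℕ → Space d} {e₀ : Space d}
    (he : Tendsto e atTop (𝓝 e₀)) {ρ : ℕ → ℝ} {ρ₀ : ℝ} (hρ : Tendsto ρ atTop (𝓝 ρ₀)) :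
    IsLargeEnsembleLimit (fun J k ↦ contraction b (e J) (ρ J) (x k)) (contractedLaw b e₀ ρ₀ γ) where
  weak := forall_tendsto_avg_iff.2 (hx.tendsto_empiricalProba_contraction he hρ)
  integrable := by
    have hint : Integrable id γ := hx.integrable
    refine (integrable_map_measure aestronglyMeasurable_id
      continuous_contraction.measurable.aemeasurable).2 ?_
    exact hint.sub (((integrable_aux_affineLSF hint).const_mul (1 - ρ₀)).smul_const e₀)
  mean := by
    have hint : Integrable id γ := hx.integrable
    rw [integral_id_contractedLaw hint]
    refine (hx.mean.sub (((hρ.const_sub 1).mul hx.tendsto_mean_aux).smul he)).congr fun J ↦ ?_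
    have hemp : Integrable id (empirical fun k : Fin J ↦ x k) :=
      (memLp_id_empirical _ 2).integrable one_le_two
    rw [← integral_empirical (f := fun y ↦ y) stronglyMeasurable_id,
      ← integral_empirical measurable_aux_affineLSF.stronglyMeasurable,
      ← integral_contraction hemp,
      integral_empirical continuous_contraction.stronglyMeasurable]

end IsTypical

theorem exists_largeEnsembleLimit {Ω : Type*} [MeasurableSpace Ω] {P : Measure Ω}
    {U : ℕ → Ω → Space d} (hγ : MemLp id 2 γ) (hslope : 0 < slope b γ) {e : Space d}
    (he : IsDirection b γ e) (hlaw : ∀ j, HasLaw (U j) γ P)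
    (hindep : Pairwise fun i j ↦ U i ⟂ᵢ[P] U j) :
    ∃ (u : (J : ℕ) → Ω → ℝ → Fin J → Space d) (μ : ℝ → ProbabilityMeasure (Space d)),
      (∀ (J : ℕ) (ω : Ω), IsContinuousTimeLimit (affineLSF d b) (fun j ↦ U j ω) (u J ω)) ∧
      (∀ᵐ ω ∂P, ∀ t : ℝ, 0 ≤ t → IsLargeEnsembleLimit (fun J ↦ u J ω t) (μ t)) ∧
      Tendsto (fun t : ℝ ↦ ∫ x, x ∂(μ t : Measure (Space d))) atTop
        (𝓝 (∫ x, contraction b e 0 x ∂γ)) := by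
  have hB : 0 ≤ intercept b γ := intercept_nonneg hγ
  choose e' he' using fun (J : ℕ) (ω : Ω) ↦
    exists_isDirection (b := b) (memLp_id_empirical (fun k : Fin J ↦ U k ω) 2)
  choose r' hr' using fun (J : ℕ) (ω : Ω) ↦ exists_isDecay
    (slope_nonneg (b := b) (ν := empirical fun k : Fin J ↦ U k ω))
    (intercept_nonneg (b := b) (memLp_id_empirical (fun k : Fin J ↦ U k ω) 2))
  obtain ⟨r, hr⟩ := exists_isDecay hslope.le hB
  refine ⟨fun J ω t j ↦ contraction b (e' J ω) (r' J ω t) (U j ω),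
    fun t ↦ contractedLaw b e (r t) γ,
    fun J ω ↦ isContinuousTimeLimit_contraction (he' J ω) (hr' J ω), ?_, ?_⟩
  · have hcov : cov[aux (affineLSF d b), fun x ↦ x 0; γ] ≠ 0 := by
      rw [← slope_add_intercept]
      positivity
    filter_upwards [ae_isTypical hγ hlaw hindep] with ω hω t ht
    exact hω.isLargeEnsembleLimit
      (IsDirection.tendsto (fun J ↦ he' J ω) he hcov hω.tendsto_covariance)
      (hr.tendsto_of_tendsto (fun J ↦ hr' J ω) hslope.le hB hω.tendsto_slope hω.tendsto_intercept
        ht)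
  · have hint := hγ.integrable one_le_two
    simp only [integral_id_contractedLaw hint, integral_contraction hint]
    exact ((((hr.tendsto_zero hslope hB).const_sub 1).mul_const _).smul_const e).const_sub _

end MeanField

section Reflection

variable {E : Type*} [NormedAddCommGroup E] [InnerProductSpace ℝ E] [MeasurableSpace E]
  [BorelSpace E]

/-- Averaging `φ x • x` with its mirror image in the line through `e` leaves only the component
along `e`. -/
theorem integral_smul_of_reflection [CompleteSpace E] {μ : Measure E} {e : E} (he : ‖e‖ = 1)
    (hμ : MeasurePreserving (ℝ ∙ e).reflection μ μ) {φ : E → ℝ}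
    (hφ : ∀ x, φ ((ℝ ∙ e).reflection x) = φ x) (hint : Integrable (fun x ↦ φ x • x) μ) :
    ∫ x, φ x • x ∂μ = (∫ x, φ x * inner ℝ e x ∂μ) • e := by
  have hpt : ∀ x, φ ((ℝ ∙ e).reflection x) • (ℝ ∙ e).reflection x =
      (2 * (φ x * inner ℝ e x)) • e - φ x • x := fun x ↦ by
    rw [hφ, Submodule.reflection_singleton_apply, he]
    module
  have hinner : Integrable (fun x ↦ φ x * inner ℝ e x) μ := by
    simpa only [inner_smul_right] using hint.const_inner (𝕜 := ℝ) e
  have hinv := hμ.integral_comp (ℝ ∙ e).reflection.toHomeomorph.measurableEmbedding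
    fun x ↦ φ x • x
  simp only [hpt] at hinv
  rw [integral_sub ((hinner.const_mul 2).smul_const e) hint, integral_smul_const,
    integral_const_mul, sub_eq_iff_eq_add, ← two_smul ℝ, mul_smul] at hinv
  exact (smul_right_injective E two_ne_zero hinv).symm

theorem measurePreserving_stdGaussian [FiniteDimensional ℝ E] (R : E ≃ₗᵢ[ℝ] E) :
    MeasurePreserving R (stdGaussian E) (stdGaussian E) :=
  ⟨R.continuous.measurable, stdGaussian_map R⟩

instance isOpenPosMeasure_stdGaussian [FiniteDimensional ℝ E] :
    (stdGaussian E).IsOpenPosMeasure := by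
  have : (gaussianReal 0 1).IsOpenPosMeasure :=
    (gaussianReal_absolutelyContinuous' 0 one_ne_zero).isOpenPosMeasure
  let T := (PiLp.continuousLinearEquiv 2 ℝ _).symm.trans
    (stdOrthonormalBasis ℝ E).repr.symm.toContinuousLinearEquiv
  have hT : (Measure.pi fun _ ↦ gaussianReal 0 1).map T = stdGaussian E := by
    rw [← stdGaussian_map (stdOrthonormalBasis ℝ E).repr.symm, ← map_pi_eq_stdGaussian,
      Measure.map_map (by fun_prop) (by fun_prop)]
    rfl
  rw [← hT]
  exact T.continuous.isOpenPosMeasure_map T.surjective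

end Reflection

section Gaussian

theorem failureProb_smul_optMean {d : ℕ} (G : Space d → ℝ) :
    failureProb G • optMean G = ∫ x in {x | G x < 0}, x ∂(stdGaussian (Space d)) := by
  rw [optMean, failureProb, ProbabilityTheory.cond, integral_smul_measure, ENNReal.toReal_inv,
    ← Measure.real, smul_smul]
  rcases eq_or_ne ((stdGaussian (Space d)).real {x | G x < 0}) 0 with h | h
  · rw [Measure.restrict_eq_zero.2 ((measureReal_eq_zero_iff (by finiteness)).1 h)]
    simp
  · rw [mul_inv_cancel₀ h, one_smul]

variable {d : ℕ} [NeZero d] {b : ℝ}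

theorem slope_pos {ν : Measure (Space d)} [IsProbabilityMeasure ν] [ν.IsOpenPosMeasure]
    (hν : MemLp id 2 ν) : 0 < slope b ν := by
  refine slope_nonneg.lt_of_ne' fun h ↦ ?_
  have hae := ae_eq_integral_of_variance_eq_zero (memLp_aux_affineLSF hν) h
  have hconst := (continuous_aux_affineLSF.ae_eq_iff_eq ν continuous_const).1 hae
  have h0 := congrFun hconst (EuclideanSpace.single 0 b)
  have h1 := congrFun hconst (EuclideanSpace.single 0 (b + 1))
  simp only [aux, affineLSF, PiLp.single_eq_same, sub_self, max_self, add_sub_cancel_left,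
    zero_le_one, sup_of_le_right] at h0 h1
  linarith

theorem reflection_single_apply_zero (x : Space d) :
    (ℝ ∙ (EuclideanSpace.single 0 1 : Space d)).reflection x 0 = x 0 := by
  rw [Submodule.reflection_singleton_apply]
  simp only [EuclideanSpace.inner_single_left, Real.ringHom_apply, one_mul, PiLp.norm_single,
    norm_one, one_pow, div_one, PiLp.sub_apply, PiLp.smul_apply, PiLp.single_eq_same, smul_eq_mul,
    mul_one, nsmul_eq_mul, Nat.cast_ofNat]
  ring

theorem setIntegral_sub_smul_single_stdGaussian {s : Set ℝ} (hs : MeasurableSet s) :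
    ∫ x in {x : Space d | x 0 ∈ s}, x - x 0 • EuclideanSpace.single 0 1 ∂(stdGaussian (Space d)) =
      0 := by
  set e : Space d := EuclideanSpace.single 0 1 with he
  set S : Set (Space d) := {x | x 0 ∈ s}
  have hinv : (ℝ ∙ e).reflection ⁻¹' S = S := by
    ext x
    simp only [S, he, Set.mem_preimage, Set.mem_ofPred_eq, reflection_single_apply_zero]
  have hmS : MeasurableSet S := hs.preimage (by fun_prop)
  have hpres := (measurePreserving_stdGaussian (ℝ ∙ e).reflection).restrict_preimage hmS
  rw [hinv] at hpres
  have hid : Integrable (fun x ↦ x) ((stdGaussian (Space d)).restrict S) :=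
    IsGaussian.integrable_id.restrict
  have hx0 : Integrable (fun x ↦ x 0) ((stdGaussian (Space d)).restrict S) :=
    (EuclideanSpace.proj (𝕜 := ℝ) 0).integrable_comp hid
  have h := integral_smul_of_reflection (φ := fun _ ↦ 1) (by simp [he]) hpres (fun _ ↦ rfl)
    (by simpa only [one_smul] using hid)
  rw [integral_sub hid (hx0.smul_const e), integral_smul_const, sub_eq_zero]
  simpa [he, EuclideanSpace.inner_single_left] using h

theorem isDirection_stdGaussian :
    IsDirection b (stdGaussian (Space d)) (EuclideanSpace.single 0 1) where
  apply_zero := by simp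
  covariance_eq i := by
    have hid : MemLp id 2 (stdGaussian (Space d)) := IsGaussian.memLp_two_id
    have hG := memLp_aux_affineLSF (b := b) hid
    have hint : Integrable (fun x : Space d ↦ aux (affineLSF d b) x • x) (stdGaussian (Space d)) :=
      memLp_one_iff_integrable.1 (hid.smul hG (p := 2) (q := 2))
    have hcov : ∀ i, cov[aux (affineLSF d b), fun x ↦ x i; stdGaussian (Space d)] =
        (∫ x, aux (affineLSF d b) x • x ∂(stdGaussian (Space d))) i := fun i ↦ by
      have hmean : ∫ x : Space d, x i ∂(stdGaussian (Space d)) = 0 :=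
        integral_strongDual_stdGaussian (EuclideanSpace.proj i)
      rw [covariance_eq_sub hG (memLp_apply hid i), hmean, mul_zero, sub_zero]
      exact (EuclideanSpace.proj (𝕜 := ℝ) i).integral_comp_comm hint
    simp only [hcov, integral_smul_of_reflection (e := EuclideanSpace.single 0 1)
      (by simp) (measurePreserving_stdGaussian _)
      (fun x ↦ by simp only [aux, affineLSF, reflection_single_apply_zero]) hint]
    simp

theorem contraction_zero_of_nonpos {e x : Space d} (hx : affineLSF d b x ≤ 0) :
    contraction b e 0 x = x := by
  simp [contraction, aux, max_eq_left hx]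

theorem contraction_zero_of_nonneg {x : Space d} (hx : 0 ≤ affineLSF d b x) :
    contraction b (EuclideanSpace.single 0 1) 0 x =
      x - x 0 • EuclideanSpace.single 0 1 + EuclideanSpace.single 0 b := by
  have hsingle : (EuclideanSpace.single 0 b : Space d) = b • EuclideanSpace.single 0 1 := by
    ext i
    simp [PiLp.single_apply]
  rw [hsingle, contraction, aux, max_eq_right hx, affineLSF]
  module

theorem setIntegral_contraction_zero_stdGaussian :
    ∫ x in {x | 0 ≤ affineLSF d b x},
        contraction b (EuclideanSpace.single 0 1) 0 x ∂(stdGaussian (Space d)) =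
      (stdGaussian (Space d)).real {x | 0 ≤ affineLSF d b x} • EuclideanSpace.single 0 b := by
  have hS : {x | 0 ≤ affineLSF d b x} = {x | x 0 ∈ Set.Ici b} := by
    ext x
    simp [affineLSF]
  have hmS : MeasurableSet {x | 0 ≤ affineLSF d b x} :=
    hS ▸ measurableSet_Ici.preimage (by fun_prop)
  have hid : Integrable (fun x : Space d ↦ x) (stdGaussian (Space d)) := IsGaussian.integrable_id
  have hsub : Integrable (fun x : Space d ↦ x - x 0 • EuclideanSpace.single 0 (1 : ℝ))
      (stdGaussian (Space d)) :=
    hid.sub (((EuclideanSpace.proj (𝕜 := ℝ) 0).integrable_comp hid).smul_const _)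
  rw [setIntegral_congr_fun hmS fun x ↦ contraction_zero_of_nonneg,
    integral_add hsub.restrict (integrable_const _), setIntegral_const, hS,
    setIntegral_sub_smul_single_stdGaussian measurableSet_Ici, zero_add]

theorem integral_contraction_zero_stdGaussian :
    ∫ x, contraction b (EuclideanSpace.single 0 1) 0 x ∂(stdGaussian (Space d)) =
      (1 - failureProb (affineLSF d b)) • EuclideanSpace.single (0 : Fin d) b +
        failureProb (affineLSF d b) • optMean (affineLSF d b) := by
  have hmS : MeasurableSet {x | affineLSF d b x < 0} :=
    (isOpen_lt (by unfold affineLSF; fun_prop) continuous_const).measurableSet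
  have hcompl : {x | affineLSF d b x < 0}ᶜ = {x | 0 ≤ affineLSF d b x} := by
    ext x
    simp
  have hid : Integrable (fun x : Space d ↦ x) (stdGaussian (Space d)) := IsGaussian.integrable_id
  have hint : Integrable (contraction b (EuclideanSpace.single 0 1) 0) (stdGaussian (Space d)) :=
    hid.sub (((integrable_aux_affineLSF hid).const_mul (1 - 0)).smul_const _)
  rw [failureProb_smul_optMean, failureProb, ← probReal_compl_eq_one_sub hmS, hcompl,
    ← setIntegral_contraction_zero_stdGaussian, ← hcompl,
    ← integral_add_compl hmS hint, add_comm]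
  congr 1
  exact setIntegral_congr_fun hmS fun x (hx : affineLSF d b x < 0) ↦
    contraction_zero_of_nonpos hx.le

end Gaussian

section MostLikelyFailurePoint

theorem isMLFP_affineLSF_iff {d : ℕ} [NeZero d] {b : ℝ} {u : Space d} :
    IsMLFP (affineLSF d b) u ↔ u = EuclideanSpace.single 0 b := by
  have hG : ∀ v : Space d, affineLSF d b v = 0 ↔ v 0 = b := fun v ↦ sub_eq_zero
  have hnorm : ‖(EuclideanSpace.single 0 b : Space d)‖ ^ 2 = b ^ 2 := by simp
  have hpythagoras : ∀ v : Space d, v 0 = b →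
      ‖v‖ ^ 2 = b ^ 2 + ‖v - EuclideanSpace.single 0 b‖ ^ 2 := fun v hv ↦ by
    rw [norm_sub_sq_real, hnorm, EuclideanSpace.inner_single_right, hv, conj_trivial]
    ring
  constructor
  · rintro ⟨h0, hmin⟩
    have hle := hmin (EuclideanSpace.single 0 b) ((hG _).2 (by simp))
    rw [hnorm, hpythagoras u ((hG u).1 h0)] at hle
    have hdist : ‖u - EuclideanSpace.single 0 b‖ ^ 2 = 0 :=
      le_antisymm (by linarith) (sq_nonneg _)
    exact sub_eq_zero.1 (norm_eq_zero.1 (sq_eq_zero_iff.1 hdist))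
  · rintro rfl
    refine ⟨(hG _).2 (by simp), fun v hv ↦ ?_⟩
    rw [hnorm, hpythagoras v ((hG v).1 hv)]
    nlinarith [sq_nonneg ‖v - EuclideanSpace.single 0 b‖]

end MostLikelyFailurePoint

end EnKF

theorem theorem3_general {d : ℕ} [NeZero d] (b : ℝ)
    {Ω : Type*} [MeasurableSpace Ω] (P : Measure Ω)
    (U₀ : ℕ → Ω → EnKF.Space d)
    (hlaw : ∀ j, HasLaw (U₀ j) (stdGaussian (EnKF.Space d)) P)
    (hindep : Pairwise fun i j ↦ U₀ i ⟂ᵢ[P] U₀ j) :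
    (∀ u : EnKF.Space d,
      EnKF.IsMLFP (EnKF.affineLSF d b) u ↔ u = EuclideanSpace.single (0 : Fin d) b) ∧
    ∃ (u : (J : ℕ) → Ω → ℝ → Fin J → EnKF.Space d)
      (μ : ℝ → ProbabilityMeasure (EnKF.Space d)),
      (∀ (J : ℕ) (ω : Ω),
        EnKF.IsContinuousTimeLimit (EnKF.affineLSF d b) (fun j ↦ U₀ j ω) (u J ω)) ∧
      (∀ᵐ ω ∂P, ∀ t : ℝ, 0 ≤ t → EnKF.IsLargeEnsembleLimit (fun J ↦ u J ω t) (μ t)) ∧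
      Tendsto (fun t : ℝ ↦ ∫ x, x ∂(μ t : Measure (EnKF.Space d))) atTop
        (𝓝 ((1 - EnKF.failureProb (EnKF.affineLSF d b)) • EuclideanSpace.single (0 : Fin d) b +
          EnKF.failureProb (EnKF.affineLSF d b) • EnKF.optMean (EnKF.affineLSF d b))) := by
  refine ⟨fun u ↦ EnKF.isMLFP_affineLSF_iff, ?_⟩
  rw [← EnKF.integral_contraction_zero_stdGaussian]
  exact EnKF.exists_largeEnsembleLimit IsGaussian.memLp_two_id
    (EnKF.slope_pos IsGaussian.memLp_two_id) EnKF.isDirection_stdGaussian hlaw hindep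

theorem theorem3 {d : ℕ} [NeZero d] (b : ℝ) (hb : b < 0)
    {Ω : Type*} [MeasurableSpace Ω] (P : Measure Ω) [IsProbabilityMeasure P]
    (U₀ : ℕ → Ω → EnKF.Space d)
    (hlaw : ∀ j, HasLaw (U₀ j) (stdGaussian (EnKF.Space d)) P)
    (hindep : iIndepFun U₀ P) :
    (∀ u : EnKF.Space d,
      EnKF.IsMLFP (EnKF.affineLSF d b) u ↔ u = EuclideanSpace.single (0 : Fin d) b) ∧
    ∃ (u : (J : ℕ) → Ω → ℝ → Fin J → EnKF.Space d)
      (μ : ℝ → ProbabilityMeasure (EnKF.Space d)),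
      (∀ (J : ℕ) (ω : Ω),
        EnKF.IsContinuousTimeLimit (EnKF.affineLSF d b) (fun j => U₀ j ω) (u J ω)) ∧
      (∀ᵐ ω ∂P, ∀ t : ℝ, 0 ≤ t → EnKF.IsLargeEnsembleLimit (fun J => u J ω t) (μ t)) ∧
      Tendsto (fun t : ℝ => ∫ x, x ∂(μ t : Measure (EnKF.Space d))) atTop
        (𝓝 ((1 - EnKF.failureProb (EnKF.affineLSF d b)) • EuclideanSpace.single (0 : Fin d) b +
          EnKF.failureProb (EnKF.affineLSF d b) • EnKF.optMean (EnKF.affineLSF d b))) :=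
  theorem3_general b P U₀ hlaw fun _ _ hij ↦ hindep.indepFun hij
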